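/- Let $m,n\ge 0$ and let $P$ be a rook placement on the rectangular board $F=\{1,\dots,m\}\times\{1,\dots,n\}$, i.e. a subset of $F$ with at most one square in each row and at most one square in each column; here $(i,j)$ denotes the square in the $i$-th column from the left and the $j$-th row from the bottom. The \emph{left pivots} of $P$ form the placement $\mathrm{piv}_L(P)$ on $F$ built row by row from bottom to top. No pivot is placed in row $1$. For $r>1$, if row $r$ contains no element of $P$, no pivot is placed in row $r$. If $X\in P$ is in row $r$, and some column to the left of $X$ contains an element of $P$ below row $r$ but contains no pivot placed so far, then a pivot is placed in row $r$ in the rightmost such column; otherwise no pivot is placed in row $r$. For a placement $Q$ on $F$, write $Q=\{(i_1,j_1),\dots,(i_k,j_k)\}$ with $i_1<\dots<i_k$, and let $\mathrm{ins}(Q)$ be the Robinson--Schensted insertion tableau of the corresponding partial permutation $i_t\mapsto j_t$, i.e. the tableau obtained from the empty tableau by inserting $j_1,\dots,j_k$ in this order by row insertion (an inserted number bumps the leftmost larger entry of a row into the next row, and is placed at the right end of the row if there is no larger entry). For a tableau $Y$, let ${}^{-}Y$ be the tableau consisting of all but the left column of $Y$. Then $$\mathrm{ins}\bigl(\mathrm{piv}_L(P)\bigr)={}^{-}\bigl(\mathrm{ins}(P)\bigr).$$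 -/

import Mathlib

namespace Rook

/-- A square `(i, j)` lies in the `i`-th column from the left and the `j`-th row from the bottom,
both counted from `1`. This is the rectangular Ferrers board with `m` columns and `n` rows. -/
def rectBoard (m n : ℕ) : Finset (ℕ × ℕ) :=
  Finset.Icc 1 m ×ˢ Finset.Icc 1 n

/-- A rook placement on a board `F`: a set of squares of `F` with at most one square in each
column and at most one square in each row. -/
structure Placement (F : Finset (ℕ × ℕ)) where
  squares : Finset (ℕ × ℕ)
  subset_board : squares ⊆ F
  column_unique : ∀ X ∈ squares, ∀ Y ∈ squares, X.1 = Y.1 → X = Y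
  row_unique : ∀ X ∈ squares, ∀ Y ∈ squares, X.2 = Y.2 → X = Y

/-! ### Left pivots -/

/-- Given the set `A` of pivots in the rows below row `r`, the columns to the left of the element
of `P` in row `r` (if there is one) that contain an element of `P` below row `r` but do not
contain a pivot. -/
def pivotCandidates (P A : Finset (ℕ × ℕ)) (r : ℕ) : Finset ℕ :=
  (P.filter fun Y =>
    Y.2 < r ∧ (∃ X ∈ P, X.2 = r ∧ Y.1 < X.1) ∧ ∀ V ∈ A, V.1 ≠ Y.1).image Prod.fst

/-- The left pivots of `P` in the rows `1, …, r`, constructed row by row from bottom to top: in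
each row a pivot is placed in the rightmost candidate column, if there is a candidate. -/
def leftPivotsUpTo (P : Finset (ℕ × ℕ)) : ℕ → Finset (ℕ × ℕ)
  | 0 => ∅
  | r + 1 =>
    let A := leftPivotsUpTo P r
    if h : (pivotCandidates P A (r + 1)).Nonempty then
      insert ((pivotCandidates P A (r + 1)).max' h, r + 1) A
    else A

theorem mem_pivotCandidates {P A : Finset (ℕ × ℕ)} {r c : ℕ}
    (h : c ∈ pivotCandidates P A r) :
    (∃ Y ∈ P, Y.1 = c ∧ Y.2 < r) ∧ (∃ X ∈ P, X.2 = r ∧ c < X.1) ∧ ∀ V ∈ A, V.1 ≠ c := by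
  simp only [pivotCandidates, Finset.mem_image, Finset.mem_filter] at h
  obtain ⟨Y, ⟨hY, hr, hX, hA⟩, rfl⟩ := h
  exact ⟨⟨Y, hY, rfl, hr⟩, hX, hA⟩

theorem leftPivotsUpTo_spec (P : Finset (ℕ × ℕ)) (r : ℕ) :
    (∀ V ∈ leftPivotsUpTo P r, V.2 ≤ r ∧ (∃ Y ∈ P, Y.1 = V.1) ∧ ∃ X ∈ P, X.2 = V.2) ∧
    (∀ V ∈ leftPivotsUpTo P r, ∀ W ∈ leftPivotsUpTo P r, V.1 = W.1 → V = W) ∧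
    (∀ V ∈ leftPivotsUpTo P r, ∀ W ∈ leftPivotsUpTo P r, V.2 = W.2 → V = W) := by
  induction r with
  | zero => simp [leftPivotsUpTo]
  | succ r ih =>
    obtain ⟨h1, h2, h3⟩ := ih
    by_cases h : (pivotCandidates P (leftPivotsUpTo P r) (r + 1)).Nonempty
    · obtain ⟨⟨Y, hY, hYc, -⟩, ⟨X, hX, hXr, -⟩, hA⟩ :=
        mem_pivotCandidates (Finset.max'_mem _ h)
      simp only [leftPivotsUpTo, dif_pos h, Finset.mem_insert]
      generalize (pivotCandidates P (leftPivotsUpTo P r) (r + 1)).max' h = c at *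
      refine ⟨?_, ?_, ?_⟩
      · rintro V (rfl | hV)
        · exact ⟨le_rfl, ⟨Y, hY, hYc⟩, ⟨X, hX, hXr⟩⟩
        · exact ⟨(h1 V hV).1.trans (Nat.le_succ r), (h1 V hV).2⟩
      · rintro V (rfl | hV) W (rfl | hW) e
        · rfl
        · exact absurd e.symm (hA W hW)
        · exact absurd e (hA V hV)
        · exact h2 V hV W hW e
      · rintro V (rfl | hV) W (rfl | hW) e
        · rfl
        · have := (h1 W hW).1
          simp only at e
          omega
        · have := (h1 V hV).1
          simp only at e
          omega
        · exact h3 V hV W hW e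
    · simp only [leftPivotsUpTo, dif_neg h]
      exact ⟨fun V hV => ⟨(h1 V hV).1.trans (Nat.le_succ r), (h1 V hV).2⟩, h2, h3⟩

/-- The placement formed by the left pivots of a placement on a rectangular board. -/
def leftPivots {m n : ℕ} (P : Placement (rectBoard m n)) : Placement (rectBoard m n) where
  squares := leftPivotsUpTo P.squares n
  subset_board := by
    intro V hV
    obtain ⟨-, ⟨Y, hY, hYV⟩, ⟨X, hX, hXV⟩⟩ := (leftPivotsUpTo_spec P.squares n).1 V hV
    have hY' := P.subset_board hY
    have hX' := P.subset_board hX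
    simp only [rectBoard, Finset.mem_product] at hX' hY' ⊢
    rw [← hYV, ← hXV]
    exact ⟨hY'.1, hX'.2⟩
  column_unique := (leftPivotsUpTo_spec P.squares n).2.1
  row_unique := (leftPivotsUpTo_spec P.squares n).2.2

/-! ### Robinson-Schensted insertion -/

/-- Insert `x` into a row: the leftmost entry larger than `x` is replaced by `x` and bumped; if
there is no such entry, `x` is placed at the right end of the row. The result is the new row
together with the bumped entry, if any. -/
def rowInsert : List ℕ → ℕ → List ℕ × Option ℕ
  | [], x => ([x], none)
  | y :: ys, x =>
    if x < y then (x :: ys, some y)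
    else (y :: (rowInsert ys x).1, (rowInsert ys x).2)

/-- Insert `x` into a tableau, given as the list of its (nonempty) rows from top to bottom:
`x` is inserted into the top row, and a bumped entry is inserted into the rows below. -/
def tableauInsert : List (List ℕ) → ℕ → List (List ℕ)
  | [], x => [[x]]
  | row :: rows, x =>
    match rowInsert row x with
    | (row', none) => row' :: rows
    | (row', some y) => row' :: tableauInsert rows y

/-- The two-line array of the partial permutation `π` of a placement `P`, where `π i = j` if and
only if `(i, j)` is in `P`: the list of the columns `(i, π i)`, with `i` increasing. -/
def twoLine {F : Finset (ℕ × ℕ)} (P : Placement F) : List (ℕ × ℕ) :=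
  ((P.squares.map toLex.toEmbedding).sort (· ≤ ·)).map ofLex

/-- The Robinson-Schensted insertion tableau `ins P` of a placement `P`: the entries of the bottom
line of the two-line array are inserted from left to right into the empty tableau. -/
def ins {F : Finset (ℕ × ℕ)} (P : Placement F) : List (List ℕ) :=
  ((twoLine P).map Prod.snd).foldl tableauInsert []

/-- The tableau consisting of all but the left column: the first entry of each row is removed,
and the rows that become empty disappear. -/
def removeLeftColumn (T : List (List ℕ)) : List (List ℕ) :=
  (T.map List.tail).filter (· ≠ [])

end Rook

namespace Rook

/-! ### Inserting a word into a row -/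

/-! Let `w` be the word of `P`. Inserting a word into the first row leaves an increasing row `A` and
bumps out a word, and the input is Knuth equivalent to the bumped word followed by `A`. Apply this
to the reverse of `w`, with bumped word `u`: since Knuth relations survive reversal, `w` is
equivalent to `A.reverse ++ v`, where `v = u.reverse`. Knuth equivalent words have equal tableaux,
so `A.reverse ++ v` has the tableau of `w`. The decreasing word `A.reverse` builds a single column,
and by Schensted (`length_insWord`) the tableau has exactly `A.length` rows. Hence `v` never
lengthens that column, never disturbs it, and is inserted beside it: removing the column leaves the
tableau of `v` (`removeLeftColumn_insWord`).

It remains to see that `v` is the word of the left pivots. Read `P` from right to left: the bumped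
letters are the pivot rows so far and the current first row consists of the occupied rows without a
pivot. A new leftmost column with its element in row `r` receives its pivot in the lowest such row
above `r`, which is exactly the entry that `r` bumps (`leftPivotsUpTo_toFinset`). -/

theorem rowInsert_perm (R : List ℕ) (x : ℕ) :
    ((rowInsert R x).1 ++ (rowInsert R x).2.toList).Perm (x :: R) := by
  induction R with
  | nil => simp [rowInsert]
  | cons a R ih =>
    by_cases h : x < a
    · simp only [rowInsert, h, if_true, Option.toList_some, List.cons_append]
      exact (List.perm_append_comm (l₂ := [a])).cons x
    · simp only [rowInsert, h, if_false, List.cons_append]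
      exact (ih.cons a).trans (List.Perm.swap x a R)

theorem mem_of_mem_rowInsert {R : List ℕ} {x y : ℕ} (h : y ∈ (rowInsert R x).1) :
    y = x ∨ y ∈ R := by
  simpa using (rowInsert_perm R x).mem_iff.1 (List.mem_append_left _ h)

theorem mem_of_rowInsert_eq_some {R : List ℕ} {x s : ℕ} (h : (rowInsert R x).2 = some s) :
    x < s ∧ s ∈ R := by
  induction R with
  | nil => simp [rowInsert] at h
  | cons a R ih =>
    by_cases hx : x < a
    · simp only [rowInsert, hx, if_true, Option.some.injEq] at h
      subst h
      simp [hx]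
    · simp only [rowInsert, hx, if_false] at h
      exact ⟨(ih h).1, List.mem_cons_of_mem _ (ih h).2⟩

theorem rowInsert_pairwise {R : List ℕ} {x : ℕ} (hR : R.Pairwise (· < ·)) (hx : x ∉ R) :
    (rowInsert R x).1.Pairwise (· < ·) := by
  induction R with
  | nil => simp [rowInsert]
  | cons a R ih =>
    rw [List.pairwise_cons] at hR
    simp only [List.mem_cons, not_or] at hx
    by_cases h : x < a
    · simp only [rowInsert, h, if_true, List.pairwise_cons]
      exact ⟨fun b hb => h.trans (hR.1 b hb), hR.2⟩
    · simp only [rowInsert, h, if_false, List.pairwise_cons]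
      refine ⟨fun b hb => ?_, ih hR.2 hx.2⟩
      rcases mem_of_mem_rowInsert hb with rfl | hb
      · omega
      · exact hR.1 b hb

/-- The row obtained by inserting the letters of a word into a row, and the word of the bumped
entries. -/
def rowInsertWord : List ℕ → List ℕ → List ℕ × List ℕ
  | R, [] => (R, [])
  | R, x :: w =>
    ((rowInsertWord (rowInsert R x).1 w).1,
      (rowInsert R x).2.toList ++ (rowInsertWord (rowInsert R x).1 w).2)

theorem rowInsertWord_append (R u v : List ℕ) :
    rowInsertWord R (u ++ v) =
      ((rowInsertWord (rowInsertWord R u).1 v).1,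
        (rowInsertWord R u).2 ++ (rowInsertWord (rowInsertWord R u).1 v).2) := by
  induction u generalizing R with
  | nil => simp [rowInsertWord]
  | cons x u ih => simp [rowInsertWord, ih]

theorem rowInsertWord_perm (R w : List ℕ) :
    ((rowInsertWord R w).1 ++ (rowInsertWord R w).2).Perm (R ++ w) := by
  induction w generalizing R with
  | nil => simp [rowInsertWord]
  | cons x w ih =>
    simp only [rowInsertWord]
    have h1 := ih (rowInsert R x).1
    have h2 := rowInsert_perm R x
    rw [List.perm_iff_count] at *
    intro c
    have h1 := h1 c
    have h2 := h2 c
    simp only [List.count_append, List.count_cons] at *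
    omega

theorem rowInsertWord_pairwise {R w : List ℕ} (hR : R.Pairwise (· < ·)) (h : (R ++ w).Nodup) :
    (rowInsertWord R w).1.Pairwise (· < ·) := by
  induction w generalizing R with
  | nil => exact hR
  | cons x w ih =>
    have hx : x ∉ R := fun hx => (List.disjoint_of_nodup_append h) hx (by simp)
    refine ih (rowInsert_pairwise hR hx) ?_
    have h1 : (x :: (R ++ w)).Nodup := (List.perm_middle.nodup_iff).1 h
    refine List.Nodup.sublist (l₂ := (rowInsert R x).1 ++ (rowInsert R x).2.toList ++ w) ?_ ?_
    · simp
    · exact (((rowInsert_perm R x).append_right w).nodup_iff).2 h1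

/-- Letters that are at least as large as the first entry of a row do not affect that entry. -/
theorem rowInsertWord_cons {a : ℕ} {w : List ℕ} (h : ∀ x ∈ w, a ≤ x) (R : List ℕ) :
    rowInsertWord (a :: R) w = (a :: (rowInsertWord R w).1, (rowInsertWord R w).2) := by
  induction w generalizing R with
  | nil => simp [rowInsertWord]
  | cons x w ih =>
    have hx : ¬ x < a := by simpa using h x (by simp)
    simp only [rowInsertWord, rowInsert, hx, if_false]
    rw [ih fun y hy => h y (by simp [hy])]

/-- The later, larger letter must pass `y`, so it lands strictly to the right of where `y` landed.
-/
theorem rowInsert_rowInsert_of_lt {R : List ℕ} {y z t : ℕ} (hR : R.Pairwise (· < ·))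
    (hyz : y < z) (h : (rowInsert (rowInsert R y).1 z).2 = some t) :
    ∃ s, (rowInsert R y).2 = some s ∧ s < t := by
  induction R with
  | nil => simp [rowInsert, hyz.not_gt] at h
  | cons a R ih =>
    rw [List.pairwise_cons] at hR
    by_cases hy : y < a
    · simp only [rowInsert, hy, if_true, hyz.not_gt, if_false] at h ⊢
      exact ⟨a, rfl, hR.1 t (mem_of_rowInsert_eq_some h).2⟩
    · have hz : ¬ z < a := by omega
      simp only [rowInsert, hy, if_false, hz] at h ⊢
      exact ih hR.2 h

/-- Once `z` sits in the row, `y` meets a larger entry at `z` at the latest. -/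
theorem rowInsert_rowInsert_of_gt {R : List ℕ} {y z : ℕ} (hyz : y < z) :
    ∃ t, (rowInsert (rowInsert R z).1 y).2 = some t ∧ t ≤ z := by
  induction R with
  | nil => exact ⟨z, by simp [rowInsert, hyz]⟩
  | cons a R ih =>
    by_cases hz : z < a
    · exact ⟨z, by simp [rowInsert, hz, hyz]⟩
    · by_cases hy : y < a
      · exact ⟨a, by simp [rowInsert, hz, hy], by omega⟩
      · simpa [rowInsert, hz, hy] using ih

/-! ### Knuth equivalence -/

/-- Knuth equivalence of words, generated by the relations between words with three distinct
letters. -/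
inductive KnuthEquiv : List ℕ → List ℕ → Prop
  | refl (w) : KnuthEquiv w w
  | symm {v w} : KnuthEquiv v w → KnuthEquiv w v
  | trans {u v w} : KnuthEquiv u v → KnuthEquiv v w → KnuthEquiv u w
  | append (u : List ℕ) {w w' : List ℕ} (v : List ℕ) :
      KnuthEquiv w w' → KnuthEquiv (u ++ w ++ v) (u ++ w' ++ v)
  | yxz {x y z : ℕ} : x < y → y < z → KnuthEquiv [y, x, z] [y, z, x]
  | xzy {x y z : ℕ} : x < y → y < z → KnuthEquiv [x, z, y] [z, x, y]

namespace KnuthEquiv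

theorem append_left (u : List ℕ) {w w' : List ℕ} (h : KnuthEquiv w w') :
    KnuthEquiv (u ++ w) (u ++ w') := by
  simpa using h.append u []

theorem append_right {w w' : List ℕ} (h : KnuthEquiv w w') (v : List ℕ) :
    KnuthEquiv (w ++ v) (w' ++ v) := by
  simpa using h.append [] v

theorem perm {w w' : List ℕ} (h : KnuthEquiv w w') : w.Perm w' := by
  induction h with
  | refl w => exact List.Perm.refl w
  | symm _ ih => exact ih.symm
  | trans _ _ ih1 ih2 => exact ih1.trans ih2
  | append u v _ ih => exact (ih.append_left u).append_right v
  | yxz _ _ => exact (List.Perm.swap _ _ _).cons _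
  | xzy _ _ => exact List.Perm.swap _ _ _

theorem reverse {w w' : List ℕ} (h : KnuthEquiv w w') : KnuthEquiv w.reverse w'.reverse := by
  induction h with
  | refl w => exact refl _
  | symm _ ih => exact ih.symm
  | trans _ _ ih1 ih2 => exact ih1.trans ih2
  | append u v _ ih => simpa using ih.append v.reverse u.reverse
  | yxz h1 h2 => simpa using (xzy h1 h2).symm
  | xzy h1 h2 => simpa using (yxz h1 h2).symm

end KnuthEquiv

theorem rowInsertWord_yxz {R : List ℕ} {x y z : ℕ} (hR : R.Pairwise (· < ·)) (hxy : x < y)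
    (hyz : y < z) (hx : x ∉ R) (hy : y ∉ R) :
    (rowInsertWord R [y, x, z]).1 = (rowInsertWord R [y, z, x]).1 ∧
      KnuthEquiv (rowInsertWord R [y, x, z]).2 (rowInsertWord R [y, z, x]).2 := by
  induction R with
  | nil =>
    have h1 : ¬ z < x := by omega
    have h2 : ¬ z < y := by omega
    simp [rowInsertWord, rowInsert, hxy, h1, h2, KnuthEquiv.refl]
  | cons a R ih =>
    have hR' := List.pairwise_cons.1 hR
    simp only [List.mem_cons, not_or] at hx hy
    have hzx : ¬ z < x := by omega
    have hzy : ¬ z < y := by omega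
    by_cases hxa : x < a
    -- Here `y` bumps `a` and `x` bumps `y`; if `z` bumps `s`, the outputs are `a, y, s` and `a, s,
    -- y` with `y < a < s`.
    · by_cases hya : y < a
      · cases ho : (rowInsert R z).2 with
        | none =>
          simp [rowInsertWord, rowInsert, hya, hxy, hzx, hzy, ho, KnuthEquiv.refl]
        | some s =>
          simp only [rowInsertWord, rowInsert, hya, hxy, hzx, hzy, ho, if_true, if_false]
          exact ⟨trivial, KnuthEquiv.yxz hya (hR'.1 s (mem_of_rowInsert_eq_some ho).2)⟩
      -- Here only `x` reaches `a`; the outputs are `s, a, t` and `s, t, a` with `a < s < t`.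
      · have hza : ¬ z < a := by omega
        cases ho : (rowInsert (rowInsert R y).1 z).2 with
        | none => simp [rowInsertWord, rowInsert, hya, hxa, hza, hzx, ho, KnuthEquiv.refl]
        | some t =>
          obtain ⟨s, hs, hst⟩ := rowInsert_rowInsert_of_lt hR'.2 hyz ho
          simp only [rowInsertWord, rowInsert, hya, hxa, hza, hzx, ho, hs, if_true, if_false]
          exact ⟨trivial, KnuthEquiv.yxz (hR'.1 s (mem_of_rowInsert_eq_some hs).2) hst⟩
    · rw [rowInsertWord_cons (by simp; omega), rowInsertWord_cons (by simp; omega)]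
      have := ih hR'.2 hx.2 hy.2
      exact ⟨by rw [this.1], this.2⟩

theorem rowInsertWord_xzy {R : List ℕ} {x y z : ℕ} (hR : R.Pairwise (· < ·)) (hxy : x < y)
    (hyz : y < z) (hx : x ∉ R) (hz : z ∉ R) :
    (rowInsertWord R [x, z, y]).1 = (rowInsertWord R [z, x, y]).1 ∧
      KnuthEquiv (rowInsertWord R [x, z, y]).2 (rowInsertWord R [z, x, y]).2 := by
  induction R with
  | nil =>
    have h1 : ¬ z < x := by omega
    have h2 : ¬ y < x := by omega
    have h3 : x < z := by omega
    simp [rowInsertWord, rowInsert, hyz, h1, h2, h3, KnuthEquiv.refl]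
  | cons a R ih =>
    have hR' := List.pairwise_cons.1 hR
    simp only [List.mem_cons, not_or] at hx hz
    have hzx : ¬ z < x := by omega
    have hyx : ¬ y < x := by omega
    have hxz : x < z := by omega
    by_cases hxa : x < a
    · by_cases hza : z < a
      · cases R with
        | nil => simp [rowInsertWord, rowInsert, hxa, hza, hxz, hzx, hyz, hyx, KnuthEquiv.refl]
        | cons b R =>
          have hab : a < b := hR'.1 b (by simp)
          have hzb : z < b := by omega
          have hyb : y < b := by omega
          simp only [rowInsertWord, rowInsert, hxa, hza, hxz, hzx, hyz, hyx, hzb, hyb, if_true,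
            if_false]
          -- The outputs are `a, b, z` and `a, z, b` with `z < a < b`: the type of the relation
          -- changes.
          exact ⟨trivial, (KnuthEquiv.yxz hza hab).symm⟩
      · obtain ⟨t, ht, htz⟩ := rowInsert_rowInsert_of_gt (R := R) hyz
        cases ho : (rowInsert R z).2 with
        | none => simp [rowInsertWord, rowInsert, hza, hxa, hyx, hzx, ho, KnuthEquiv.refl]
        | some s =>
          simp only [rowInsertWord, rowInsert, hza, hxa, hyx, hzx, ho, ht, if_true, if_false]
          refine ⟨trivial, KnuthEquiv.xzy ?_ (htz.trans_lt (mem_of_rowInsert_eq_some ho).1)⟩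
          rcases mem_of_mem_rowInsert (mem_of_rowInsert_eq_some ht).2 with rfl | h
          · omega
          · exact hR'.1 t h
    · rw [rowInsertWord_cons (by simp; omega), rowInsertWord_cons (by simp; omega)]
      have := ih hR'.2 hx.2 hz.2
      exact ⟨by rw [this.1], this.2⟩

/-- Knuth equivalent words produce the same row, and bump Knuth equivalent words. -/
theorem KnuthEquiv.rowInsertWord {w w' : List ℕ} (h : KnuthEquiv w w') {R : List ℕ}
    (hR : R.Pairwise (· < ·)) (hw : (R ++ w).Nodup) :
    (rowInsertWord R w).1 = (rowInsertWord R w').1 ∧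
      KnuthEquiv (rowInsertWord R w).2 (rowInsertWord R w').2 := by
  induction h generalizing R with
  | refl w => exact ⟨rfl, refl _⟩
  | symm h ih =>
    have := ih hR (((h.perm.append_left R).nodup_iff).2 hw)
    exact ⟨this.1.symm, this.2.symm⟩
  | trans h _ ih1 ih2 =>
    have h1 := ih1 hR hw
    have h2 := ih2 hR (((h.perm.append_left R).nodup_iff).1 hw)
    exact ⟨h1.1.trans h2.1, h1.2.trans h2.2⟩
  | @append u w w' v _ ih =>
    have hw1 : ((R ++ u) ++ w).Nodup := hw.sublist (by simp)
    have hu : (R ++ u).Nodup := hw1.sublist (by simp)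
    have h1 := ih (rowInsertWord_pairwise hR hu) (by
      have := (((rowInsertWord_perm R u).append_right w).nodup_iff).2 hw1
      exact this.sublist (by simp))
    simp only [rowInsertWord_append, h1.1]
    exact ⟨trivial, h1.2.append _ _⟩
  | @yxz x y z h1 h2 =>
    have := List.disjoint_of_nodup_append hw
    exact rowInsertWord_yxz hR h1 h2 (fun h => this h (by simp)) (fun h => this h (by simp))
  | @xzy x y z h1 h2 =>
    have := List.disjoint_of_nodup_append hw
    exact rowInsertWord_xzy hR h1 h2 (fun h => this h (by simp)) (fun h => this h (by simp))

/-! ### Recovering a word from its first row and its bumped word, up to Knuth equivalence -/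

theorem knuthEquiv_append_singleton_of_lt {a y : ℕ} {R : List ℕ}
    (hR : (a :: R).Pairwise (· < ·)) (hy : y < a) :
    KnuthEquiv (a :: R ++ [y]) (a :: y :: R) := by
  induction R generalizing a with
  | nil => exact KnuthEquiv.refl _
  | cons b R ih =>
    have hR' := List.pairwise_cons.1 hR
    have hab := hR'.1 b (by simp)
    have h1 := (ih hR'.2 (hy.trans hab)).append_left [a]
    exact h1.trans ((KnuthEquiv.yxz hy hab).symm.append_right R)

theorem exists_rowInsert_eq_cons {R : List ℕ} {x : ℕ} : ∃ h T, (rowInsert R x).1 = h :: T ∧ h ≤ x := by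
  cases R with
  | nil => exact ⟨x, [], rfl, le_rfl⟩
  | cons a R =>
    by_cases h : x < a
    · exact ⟨x, R, by simp [rowInsert, h], le_rfl⟩
    · exact ⟨a, (rowInsert R x).1, by simp [rowInsert, h], by omega⟩

/-- By `yxz` moves the letter `y` travels left until it stands just after the entry `s` that it
bumps; by `xzy` moves `s` then travels to the front. -/
theorem rowInsert_knuthEquiv {R : List ℕ} {y : ℕ} (hR : R.Pairwise (· < ·)) (hy : y ∉ R) :
    KnuthEquiv (R ++ [y]) ((rowInsert R y).2.toList ++ (rowInsert R y).1) := by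
  induction R with
  | nil => exact KnuthEquiv.refl _
  | cons a R ih =>
    have hR' := List.pairwise_cons.1 hR
    simp only [List.mem_cons, not_or] at hy
    by_cases h : y < a
    · simpa [rowInsert, h] using knuthEquiv_append_singleton_of_lt hR h
    · have ih := (ih hR'.2 hy.2).append_left [a]
      simp only [rowInsert, h, if_false]
      refine ih.trans ?_
      cases ho : (rowInsert R y).2 with
      | none => exact KnuthEquiv.refl _
      | some s =>
        -- The entry `b` after `a` in the new row is the witness that lets `s` pass `a`, since `a <
        -- b ≤ y < s`.
        obtain ⟨b, T, hT, hb⟩ := exists_rowInsert_eq_cons (R := R) (x := y)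
        have hab : a < b := by
          rcases mem_of_mem_rowInsert (R := R) (x := y) (y := b) (by simp [hT]) with rfl | hb
          · omega
          · exact hR'.1 b hb
        rw [hT]
        exact (KnuthEquiv.xzy hab (hb.trans_lt (mem_of_rowInsert_eq_some ho).1)).append_right T

theorem rowInsertWord_knuthEquiv {R w : List ℕ} (hR : R.Pairwise (· < ·)) (h : (R ++ w).Nodup) :
    KnuthEquiv (R ++ w) ((rowInsertWord R w).2 ++ (rowInsertWord R w).1) := by
  induction w using List.reverseRecOn with
  | nil => simpa [rowInsertWord] using KnuthEquiv.refl R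
  | append_singleton w y ih =>
    rw [← List.append_assoc] at h ⊢
    have hn : (R ++ w).Nodup := h.sublist (by simp)
    refine ((ih hn).append_right [y]).trans ?_
    have hy : y ∉ (rowInsertWord R w).1 := fun hy =>
      List.disjoint_of_nodup_append h
        ((rowInsertWord_perm R w).mem_iff.1 (List.mem_append_left _ hy)) (by simp)
    have := (rowInsert_knuthEquiv (rowInsertWord_pairwise hR hn) hy).append_left
      (rowInsertWord R w).2
    simpa [rowInsertWord_append, rowInsertWord] using this

/-! ### The insertion tableau of a word -/

/-- The first row of the insertion tableau of a word. -/
def firstRow (w : List ℕ) : List ℕ := (rowInsertWord [] w).1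

/-- The word of the entries bumped out of the first row. -/
def bumpedWord (w : List ℕ) : List ℕ := (rowInsertWord [] w).2

/-- The insertion tableau of a word. -/
def insWord (w : List ℕ) : List (List ℕ) := w.foldl tableauInsert []

theorem foldl_tableauInsert_cons (R : List ℕ) (T : List (List ℕ)) (w : List ℕ) :
    w.foldl tableauInsert (R :: T) =
      (rowInsertWord R w).1 :: (rowInsertWord R w).2.foldl tableauInsert T := by
  induction w generalizing R T with
  | nil => rfl
  | cons x w ih =>
    rcases h : rowInsert R x with ⟨R', _ | s⟩ <;>
      simp [tableauInsert, rowInsertWord, h, ih]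

theorem insWord_eq {w : List ℕ} (hw : w ≠ []) :
    insWord w = firstRow w :: insWord (bumpedWord w) := by
  cases w with
  | nil => exact absurd rfl hw
  | cons x w =>
    simp [insWord, firstRow, bumpedWord, rowInsertWord, tableauInsert, rowInsert,
      foldl_tableauInsert_cons]

theorem firstRow_pairwise {w : List ℕ} (hw : w.Nodup) : (firstRow w).Pairwise (· < ·) :=
  rowInsertWord_pairwise List.Pairwise.nil (by simpa)

theorem firstRow_append_bumpedWord_perm (w : List ℕ) : (firstRow w ++ bumpedWord w).Perm w := by
  simpa [firstRow, bumpedWord] using rowInsertWord_perm [] w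

theorem bumpedWord_nodup {w : List ℕ} (hw : w.Nodup) : (bumpedWord w).Nodup :=
  (((firstRow_append_bumpedWord_perm w).nodup_iff).2 hw).sublist (by simp)

theorem firstRow_ne_nil {w : List ℕ} (hw : w ≠ []) : firstRow w ≠ [] := by
  obtain ⟨u, x, rfl⟩ := List.eq_nil_or_concat' w |>.resolve_left hw
  obtain ⟨h, T, hT, -⟩ := exists_rowInsert_eq_cons (R := (rowInsertWord [] u).1) (x := x)
  simp [firstRow, rowInsertWord_append, rowInsertWord, hT]

theorem length_bumpedWord_lt {w : List ℕ} (hw : w ≠ []) : (bumpedWord w).length < w.length := by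
  have h1 := (firstRow_append_bumpedWord_perm w).length_eq
  have h2 := List.length_pos_iff.2 (firstRow_ne_nil hw)
  simp only [List.length_append] at h1
  omega

theorem knuthEquiv_bumpedWord_append_firstRow {w : List ℕ} (hw : w.Nodup) :
    KnuthEquiv w (bumpedWord w ++ firstRow w) := by
  simpa [firstRow, bumpedWord] using rowInsertWord_knuthEquiv (R := []) List.Pairwise.nil (by simpa)

/-- Knuth equivalent words have the same insertion tableau. -/
theorem KnuthEquiv.insWord_eq {w w' : List ℕ} (h : KnuthEquiv w w') (hw : w.Nodup) :
    insWord w = insWord w' := by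
  induction hl : w.length using Nat.strong_induction_on generalizing w w' with
  | _ l ih =>
    by_cases hn : w = []
    · subst hn
      rw [h.perm.nil_eq]
    · have hn' : w' ≠ [] := fun h' => hn (by simpa [h'] using h.perm)
      have hk := h.rowInsertWord (R := []) List.Pairwise.nil (by simpa)
      rw [Rook.insWord_eq hn, Rook.insWord_eq hn', firstRow, firstRow, hk.1]
      exact congrArg _ (ih _ (hl ▸ length_bumpedWord_lt hn) hk.2 (bumpedWord_nodup hw) rfl)

/-! ### The number of rows and the left column -/

theorem rowInsertWord_reverse {a : ℕ} {R : List ℕ} (h : (a :: R).Pairwise (· < ·)) :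
    rowInsertWord [] (a :: R).reverse = ([a], R.reverse) := by
  induction R generalizing a with
  | nil => rfl
  | cons b R ih =>
    have h' := List.pairwise_cons.1 h
    have hab : a < b := h'.1 b (by simp)
    rw [List.reverse_cons, rowInsertWord_append, ih h'.2]
    simp [rowInsertWord, rowInsert, hab]

/-- The first entry of a row never increases, and just after a letter is inserted it is at most that
letter. -/
theorem le_of_rowInsertWord_eq_cons {R w T : List ℕ} {h : ℕ}
    (e : (rowInsertWord R w).1 = h :: T) : (∀ x ∈ w, h ≤ x) ∧ ∀ a ∈ R.head?, h ≤ a := by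
  induction w generalizing R with
  | nil =>
    simp only [rowInsertWord] at e
    simp [e]
  | cons x w ih =>
    obtain ⟨b, U, hU, hb⟩ := exists_rowInsert_eq_cons (R := R) (x := x)
    obtain ⟨h1, h2⟩ := ih e
    have h2 : h ≤ b := h2 b (by simp [hU])
    refine ⟨by simpa using ⟨h2.trans hb, h1⟩, fun a ha => h2.trans ?_⟩
    cases R with
    | nil => simp at ha
    | cons c R =>
      simp only [List.head?_cons, Option.mem_def, Option.some.injEq] at ha
      subst ha
      by_cases hx : x < c
      · simp only [rowInsert, hx, if_true, List.cons.injEq] at hU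
        omega
      · simp only [rowInsert, hx, if_false, List.cons.injEq] at hU
        omega

/-- The reverse of `w` is equivalent to the reversed first row followed by the reversed bumped word.
The former leaves just `[a]` in the row; as `a` is the least letter, the latter is then inserted to
its right as into an empty row. -/
theorem length_firstRow_reverse {w : List ℕ} (hw : w.Nodup) (hn : w ≠ []) :
    (firstRow w.reverse).length = (firstRow (bumpedWord w).reverse).length + 1 := by
  obtain ⟨a, R, hR⟩ := List.exists_cons_of_ne_nil (firstRow_ne_nil hn)
  have hk := ((knuthEquiv_bumpedWord_append_firstRow hw).reverse.rowInsertWord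
    (R := []) List.Pairwise.nil (by simpa)).1
  have hp := firstRow_pairwise hw
  rw [hR] at hp hk
  rw [List.reverse_append, rowInsertWord_append, rowInsertWord_reverse hp,
    rowInsertWord_cons] at hk
  · simp [firstRow, hk]
  · intro x hx
    refine (le_of_rowInsertWord_eq_cons hR).1 x ?_
    exact (firstRow_append_bumpedWord_perm w).mem_iff.1
      (List.mem_append_right _ (List.mem_reverse.1 hx))

theorem length_insWord {w : List ℕ} (hw : w.Nodup) :
    (insWord w).length = (firstRow w.reverse).length := by
  induction hl : w.length using Nat.strong_induction_on generalizing w with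
  | _ l ih =>
    by_cases hn : w = []
    · subst hn
      rfl
    · rw [insWord_eq hn, length_firstRow_reverse hw hn, List.length_cons,
        ih _ (hl ▸ length_bumpedWord_lt hn) (bumpedWord_nodup hw) rfl]

/-! ### Inserting a word beside a column -/

theorem mem_rowInsertWord_of_lt {d y : ℕ} {v : List ℕ} (hy : y ∈ v) (hyd : y < d) (R : List ℕ) :
    d ∈ (rowInsertWord (d :: R) v).2 := by
  induction v generalizing R with
  | nil => simp at hy
  | cons x v ih =>
    by_cases hx : x < d
    · simp [rowInsertWord, rowInsert, hx]
    · have hy : y ∈ v := by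
        rcases List.mem_cons.1 hy with rfl | hy
        · exact absurd hyd hx
        · exact hy
      simp only [rowInsertWord, rowInsert, hx, if_false]
      exact List.mem_append_right _ (ih hy _)

theorem insWord_reverse_append {d : ℕ} {A : List ℕ} (hA : (d :: A).Pairwise (· < ·))
    (v : List ℕ) :
    insWord ((d :: A).reverse ++ v) =
      (rowInsertWord [d] v).1 :: insWord (A.reverse ++ (rowInsertWord [d] v).2) := by
  rw [insWord_eq (by simp), firstRow, bumpedWord, rowInsertWord_append, rowInsertWord_reverse hA]

/-- The letter `y` forces the head `d` of the column into the next row, where `d` is below the rest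
of `A` and plays the role of `y`. At the bottom an extra row appears. -/
theorem length_lt_length_insWord {A v : List ℕ} {y : ℕ} (hA : A.Pairwise (· < ·)) (hy : y ∈ v)
    (h : ∀ a ∈ A, y < a) : A.length < (insWord (A.reverse ++ v)).length := by
  induction A generalizing v y with
  | nil =>
    have hv : v ≠ [] := List.ne_nil_of_mem hy
    simp [insWord_eq hv]
  | cons d A ih =>
    have hA' := List.pairwise_cons.1 hA
    rw [insWord_reverse_append hA, List.length_cons, List.length_cons]
    exact Nat.succ_lt_succ (ih hA'.2 (mem_rowInsertWord_of_lt hy (h d (by simp)) []) hA'.1)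

theorem removeLeftColumn_insWord_reverse_append {A v : List ℕ} (hA : A.Pairwise (· < ·))
    (h : (insWord (A.reverse ++ v)).length = A.length) :
    removeLeftColumn (insWord (A.reverse ++ v)) = insWord v := by
  induction A generalizing v with
  | nil =>
    rw [List.length_nil, List.length_eq_zero_iff] at h
    have h' : insWord v = [] := by simpa using h
    rw [h, h']
    rfl
  | cons d A ih =>
    have hA' := List.pairwise_cons.1 hA
    -- A letter below `d` would add a row. Hence `v` leaves `d` in place and bumps what it would
    -- bump from an empty row.
    have hv : ∀ x ∈ v, d ≤ x := by
      intro x hx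
      by_contra! hxd
      refine (length_lt_length_insWord hA hx fun a ha => ?_).ne' h
      rcases List.mem_cons.1 ha with rfl | ha
      · exact hxd
      · exact hxd.trans (hA'.1 a ha)
    rw [insWord_reverse_append hA, rowInsertWord_cons hv] at h ⊢
    have ih := ih hA'.2 (Nat.succ_injective h)
    by_cases hn : v = []
    · subst hn
      simpa [removeLeftColumn, rowInsertWord] using ih
    · have hr := firstRow_ne_nil hn
      rw [insWord_eq hn]
      simp only [firstRow] at hr
      rw [bumpedWord, firstRow, ← ih]
      simp [removeLeftColumn, hr]

/-- Removing the left column of the insertion tableau of a word amounts to passing to the word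
of the entries bumped by reading the word from right to left. -/
theorem removeLeftColumn_insWord {w : List ℕ} (hw : w.Nodup) :
    removeLeftColumn (insWord w) = insWord (bumpedWord w.reverse).reverse := by
  have hw' : w.reverse.Nodup := List.nodup_reverse.2 hw
  have hk := (knuthEquiv_bumpedWord_append_firstRow hw').reverse
  rw [List.reverse_reverse, List.reverse_append] at hk
  have he := hk.insWord_eq hw
  rw [he]
  refine removeLeftColumn_insWord_reverse_append (firstRow_pairwise hw') ?_
  rw [← he, length_insWord hw]

/-! ### Left pivots, column by column -/

/-- Place a pivot in row `r`, in the last column of `S` if there is one. -/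
def placeMax (S : Finset ℕ) (r : ℕ) (A : Finset (ℕ × ℕ)) : Finset (ℕ × ℕ) :=
  if h : S.Nonempty then insert (S.max' h, r) A else A

theorem leftPivotsUpTo_succ (P : Finset (ℕ × ℕ)) (k : ℕ) :
    leftPivotsUpTo P (k + 1) =
      placeMax (pivotCandidates P (leftPivotsUpTo P k) (k + 1)) (k + 1) (leftPivotsUpTo P k) :=
  rfl

theorem placeMax_empty (r : ℕ) (A : Finset (ℕ × ℕ)) : placeMax ∅ r A = A := by
  simp [placeMax]

theorem placeMax_singleton (c r : ℕ) (A : Finset (ℕ × ℕ)) :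
    placeMax {c} r A = insert (c, r) A := by
  simp [placeMax]

theorem placeMax_insert_left {S : Finset ℕ} {c : ℕ} (hS : S.Nonempty) (hc : ∀ b ∈ S, c < b)
    (r : ℕ) (A : Finset (ℕ × ℕ)) : placeMax (insert c S) r A = placeMax S r A := by
  have : (insert c S).max' (Finset.insert_nonempty c S) = S.max' hS := by
    rw [Finset.max'_insert]
    exact max_eq_right (hc _ (S.max'_mem hS)).le
  simp [placeMax, hS, this]

theorem placeMax_insert_right (S : Finset ℕ) (r : ℕ) (X : ℕ × ℕ) (A : Finset (ℕ × ℕ)) :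
    placeMax S r (insert X A) = insert X (placeMax S r A) := by
  unfold placeMax
  split_ifs
  · exact Finset.insert_comm _ _ _
  · rfl

/-- No column lies to the left of the new element, so it creates no candidates in its own row; its
column `c` is to the left of every other element. -/
theorem pivotCandidates_insert {P A : Finset (ℕ × ℕ)} {c r : ℕ} (hc : ∀ Y ∈ P, c < Y.1) (k : ℕ) :
    pivotCandidates (insert (c, r) P) A k =
      if r < k ∧ (∃ X ∈ P, X.2 = k) ∧ ∀ V ∈ A, V.1 ≠ c then insert c (pivotCandidates P A k)
      else pivotCandidates P A k := by
  have key : ∀ b, b ∈ pivotCandidates (insert (c, r) P) A k ↔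
      (b = c ∧ r < k ∧ (∃ X ∈ P, X.2 = k) ∧ ∀ V ∈ A, V.1 ≠ c) ∨ b ∈ pivotCandidates P A k := by
    intro b
    simp only [pivotCandidates, Finset.mem_image, Finset.mem_filter, Finset.mem_insert]
    constructor
    · rintro ⟨Y, ⟨hY, hr, ⟨X, hX, hXk, hYX⟩, hA⟩, rfl⟩
      rcases hY with rfl | hY
      · rcases hX with rfl | hX
        · exact absurd hYX (lt_irrefl _)
        · exact Or.inl ⟨rfl, hr, ⟨X, hX, hXk⟩, hA⟩
      · rcases hX with rfl | hX
        · exact absurd hYX (hc Y hY).not_gt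
        · exact Or.inr ⟨Y, ⟨hY, hr, ⟨X, hX, hXk, hYX⟩, hA⟩, rfl⟩
    · rintro (⟨rfl, hr, ⟨X, hX, hXk⟩, hA⟩ | ⟨Y, ⟨hY, hr, ⟨X, hX, hXk, hYX⟩, hA⟩, rfl⟩)
      · exact ⟨(b, r), ⟨Or.inl rfl, hr, ⟨X, Or.inr hX, hXk, hc X hX⟩, hA⟩, rfl⟩
      · exact ⟨Y, ⟨Or.inr hY, hr, ⟨X, Or.inr hX, hXk, hYX⟩, hA⟩, rfl⟩
  ext b
  rw [key]
  split_ifs with h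
  · rw [Finset.mem_insert, and_iff_left h]
  · simp only [h, and_false, false_or]

theorem pivotCandidates_insert_right {P A : Finset (ℕ × ℕ)} {V : ℕ × ℕ} (hV : ∀ Y ∈ P, V.1 < Y.1)
    (k : ℕ) : pivotCandidates P (insert V A) k = pivotCandidates P A k := by
  unfold pivotCandidates
  congr 1
  refine Finset.filter_congr fun Y hY => ?_
  have := (hV Y hY).ne
  simp [this]

theorem lt_of_mem_pivotCandidates {P A : Finset (ℕ × ℕ)} {c k b : ℕ} (hc : ∀ Y ∈ P, c < Y.1)
    (hb : b ∈ pivotCandidates P A k) : c < b := by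
  obtain ⟨⟨Y, hY, rfl, -⟩, -⟩ := mem_pivotCandidates hb
  exact hc Y hY

/-- There is a pivot in row `k + 1` if and only if there is a candidate for it. -/
theorem pivotCandidates_nonempty_iff (P : Finset (ℕ × ℕ)) (k : ℕ) :
    (pivotCandidates P (leftPivotsUpTo P k) (k + 1)).Nonempty ↔
      ∃ V ∈ leftPivotsUpTo P (k + 1), V.2 = k + 1 := by
  rw [leftPivotsUpTo_succ, placeMax]
  split_ifs with h
  · simp [h]
  · simp only [h, false_iff]
    rintro ⟨V, hV, e⟩
    have := ((leftPivotsUpTo_spec P k).1 V hV).1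
    omega

/-- The effect on the left pivots of a new leftmost column `c` with an element in row `r`: if `o`
is the lowest row above `r` that contains an element but no pivot, then a pivot is placed in
row `o` of column `c`. -/
theorem leftPivotsUpTo_insert {P : Finset (ℕ × ℕ)} {c r : ℕ} (hc : ∀ Y ∈ P, c < Y.1)
    (o : Option ℕ)
    (h1 : ∀ s ∈ o, r < s ∧ ∀ k, s = k + 1 →
      ¬ (pivotCandidates P (leftPivotsUpTo P k) (k + 1)).Nonempty ∧ ∃ X ∈ P, X.2 = k + 1)
    (h2 : ∀ k, r < k + 1 → (∃ X ∈ P, X.2 = k + 1) → (∀ s ∈ o, k + 1 < s) →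
      (pivotCandidates P (leftPivotsUpTo P k) (k + 1)).Nonempty) (k : ℕ) :
    leftPivotsUpTo (insert (c, r) P) k =
      leftPivotsUpTo P k ∪ (o.toFinset.filter (· ≤ k)).image (Prod.mk c) := by
  have hA : ∀ k, ∀ V ∈ leftPivotsUpTo P k, V.1 ≠ c := by
    intro k V hV e
    obtain ⟨-, ⟨Y, hY, hYV⟩, -⟩ := (leftPivotsUpTo_spec P k).1 V hV
    have := hc Y hY
    omega
  induction k with
  | zero =>
    have : o.toFinset.filter (· ≤ 0) = ∅ := by
      refine Finset.filter_eq_empty_iff.2 fun s hs => ?_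
      have := (h1 s (by simpa using hs)).1
      omega
    rw [this]
    rfl
  | succ k ih =>
    rw [leftPivotsUpTo_succ, leftPivotsUpTo_succ, ih]
    -- Once column `c` has its pivot it is no longer a candidate. In row `o` it is the only
    -- candidate; before that, wherever it is a candidate, one further right wins.
    by_cases hs : ∃ s ∈ o, s ≤ k
    · obtain ⟨s, rfl, hs⟩ := hs
      have e1 : (some s).toFinset.filter (· ≤ k) = {s} := by
        ext t; simp; omega
      have e2 : (some s).toFinset.filter (· ≤ k + 1) = {s} := by
        ext t; simp; omega
      rw [e1, e2, Finset.image_singleton, Finset.union_comm, ← Finset.insert_eq,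
        pivotCandidates_insert hc, if_neg (by simp), pivotCandidates_insert_right hc,
        placeMax_insert_right, Finset.union_comm, ← Finset.insert_eq]
    · push Not at hs
      have e1 : o.toFinset.filter (· ≤ k) = ∅ := by
        refine Finset.filter_eq_empty_iff.2 fun s h => ?_
        have := hs s (by simpa using h)
        omega
      rw [e1, Finset.image_empty, Finset.union_empty, pivotCandidates_insert hc]
      by_cases hk : k + 1 ∈ o
      · obtain ⟨hr, h⟩ := h1 _ hk
        obtain ⟨hn, hX⟩ := h k rfl
        have e2 : o.toFinset.filter (· ≤ k + 1) = {k + 1} := by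
          rw [Option.mem_def] at hk
          subst hk
          ext t; simp; omega
        rw [if_pos ⟨hr, hX, hA k⟩, e2, Finset.not_nonempty_iff_eq_empty.1 hn, insert_empty_eq,
          placeMax_singleton, placeMax_empty, Finset.image_singleton, Finset.union_comm,
          ← Finset.insert_eq]
      · have hs' : ∀ s ∈ o, k + 1 < s := by
          intro s h
          have := hs s h
          have : s ≠ k + 1 := by rintro rfl; exact hk h
          omega
        have e2 : o.toFinset.filter (· ≤ k + 1) = ∅ := by
          refine Finset.filter_eq_empty_iff.2 fun s h => ?_
          have := hs' s (by simpa using h)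
          omega
        rw [e2, Finset.image_empty, Finset.union_empty]
        split_ifs with h
        · exact placeMax_insert_left (h2 k h.1 h.2.1 hs')
            (fun b hb => lt_of_mem_pivotCandidates hc hb) _ _
        · rfl

/-- The pairs of columns and bumped rows obtained by inserting the rows of a list of squares, from
the last square to the first. -/
def pivotList : List (ℕ × ℕ) → List (ℕ × ℕ)
  | [] => []
  | X :: L =>
    (rowInsert (firstRow (L.map Prod.snd).reverse) X.2).2.toList.map (Prod.mk X.1) ++ pivotList L

theorem map_snd_pivotList (L : List (ℕ × ℕ)) :
    (pivotList L).map Prod.snd = (bumpedWord (L.map Prod.snd).reverse).reverse := by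
  induction L with
  | nil => rfl
  | cons X L ih =>
    simp only [pivotList, List.map_append, ih, List.map_map, List.map_cons, List.reverse_cons,
      bumpedWord, rowInsertWord_append, rowInsertWord, List.append_nil, List.reverse_append,
      firstRow]
    cases (rowInsert (rowInsertWord [] (List.map Prod.snd L).reverse).1 X.2).2 <;> simp

theorem map_fst_pivotList_sublist (L : List (ℕ × ℕ)) :
    ((pivotList L).map Prod.fst).Sublist (L.map Prod.fst) := by
  induction L with
  | nil => simp [pivotList]
  | cons X L ih =>
    simp only [pivotList, List.map_append, List.map_map, List.map_cons]
    cases (rowInsert (firstRow (L.map Prod.snd).reverse) X.2).2 with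
    | none => simpa using ih.cons _
    | some s => simpa using ih

/-- In an increasing row the leftmost larger entry is the least one; this makes the bumped entry the
lowest free row above `r`. -/
theorem rowInsert_of_mem_of_lt {R : List ℕ} {x t : ℕ} (hR : R.Pairwise (· < ·)) (ht : t ∈ R)
    (hx : x < t) : ∃ s ∈ (rowInsert R x).2, s ≤ t := by
  induction R with
  | nil => simp at ht
  | cons a R ih =>
    have hR' := List.pairwise_cons.1 hR
    by_cases h : x < a
    · refine ⟨a, by simp [rowInsert, h], ?_⟩
      rcases List.mem_cons.1 ht with rfl | ht
      · exact le_rfl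
      · exact (hR'.1 t ht).le
    · rcases List.mem_cons.1 ht with rfl | ht
      · exact absurd hx h
      · simpa [rowInsert, h] using ih hR'.2 ht

/-- The left pivots, constructed column by column from right to left. -/
theorem leftPivotsUpTo_toFinset {L : List (ℕ × ℕ)} (h1 : (L.map Prod.fst).Pairwise (· < ·))
    (h2 : (L.map Prod.snd).Nodup) (k : ℕ) :
    leftPivotsUpTo L.toFinset k = (pivotList L).toFinset.filter (·.2 ≤ k) := by
  induction L generalizing k with
  | nil =>
    induction k with
    | zero => rfl
    | succ k ih =>
      rw [leftPivotsUpTo_succ, ih]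
      simp [pivotList, pivotCandidates, placeMax_empty]
  | cons X L ih =>
    obtain ⟨c, r⟩ := X
    simp only [List.map_cons, List.pairwise_cons, List.nodup_cons] at h1 h2
    have ih := ih h1.2 h2.2
    have hw : (L.map Prod.snd).reverse.Nodup := List.nodup_reverse.2 h2.2
    set w := (L.map Prod.snd).reverse with hwdef
    have hc : ∀ Y ∈ L.toFinset, c < Y.1 := fun Y hY =>
      h1.1 _ (List.mem_map_of_mem (List.mem_toFinset.1 hY))
    -- By induction the bumped letters are the rows with a pivot. With `hm` and `hd`, the first row
    -- consists of the occupied rows without one.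
    have hp : ∀ k, (pivotCandidates L.toFinset (leftPivotsUpTo L.toFinset k) (k + 1)).Nonempty ↔
        k + 1 ∈ bumpedWord w := by
      intro k
      rw [pivotCandidates_nonempty_iff, ih, ← List.mem_reverse, hwdef, ← map_snd_pivotList,
        List.mem_map]
      refine exists_congr fun V => ?_
      simp only [Finset.mem_filter, List.mem_toFinset]
      exact ⟨fun h => ⟨h.1.1, h.2⟩, fun h => ⟨⟨h.1, h.2.le⟩, h.2⟩⟩
    have hm : ∀ k, (∃ X ∈ L.toFinset, X.2 = k) ↔ k ∈ firstRow w ∨ k ∈ bumpedWord w := by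
      intro k
      rw [← List.mem_append, (firstRow_append_bumpedWord_perm w).mem_iff, hwdef]
      simp
    have hd := List.disjoint_of_nodup_append
      (((firstRow_append_bumpedWord_perm w).nodup_iff).2 hw)
    rw [List.toFinset_cons, leftPivotsUpTo_insert hc (rowInsert (firstRow w) r).2 ?_ ?_, ih]
    · ext ⟨a, b⟩
      simp only [pivotList, ← hwdef, Finset.mem_union, Finset.mem_filter, List.mem_toFinset,
        Finset.mem_image, Option.mem_toFinset, List.mem_append, List.mem_map, Option.mem_toList,
        Prod.mk.injEq]
      constructor
      · rintro (h | ⟨s, ⟨hs, hk⟩, rfl, rfl⟩)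
        · exact ⟨Or.inr h.1, h.2⟩
        · exact ⟨Or.inl ⟨s, hs, rfl, rfl⟩, hk⟩
      · rintro ⟨⟨s, hs, rfl, rfl⟩ | h, hk⟩
        · exact Or.inr ⟨s, ⟨hs, hk⟩, rfl, rfl⟩
        · exact Or.inl ⟨h, hk⟩
    · intro s hs
      obtain ⟨hrs, hsR⟩ := mem_of_rowInsert_eq_some hs
      refine ⟨hrs, ?_⟩
      rintro k rfl
      exact ⟨fun h => hd hsR ((hp k).1 h), (hm _).2 (Or.inl hsR)⟩
    · intro k hr hX hs
      rw [hp]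
      refine ((hm _).1 hX).resolve_left fun hk => ?_
      obtain ⟨s, hs', hle⟩ := rowInsert_of_mem_of_lt (firstRow_pairwise hw) hk hr
      exact absurd (hs s hs') (by omega)

/-! ### The two-line array of a placement -/

theorem mem_twoLine {F : Finset (ℕ × ℕ)} {P : Placement F} {X : ℕ × ℕ} :
    X ∈ twoLine P ↔ X ∈ P.squares := by
  simp [twoLine]

theorem twoLine_pairwise {F : Finset (ℕ × ℕ)} (P : Placement F) :
    ((twoLine P).map Prod.fst).Pairwise (· < ·) := by
  have hs : (twoLine P).Pairwise fun X Y => toLex X < toLex Y := by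
    rw [twoLine, List.pairwise_map]
    exact Finset.sortedLT_sort _ |>.pairwise
  rw [List.pairwise_map]
  refine hs.imp_of_mem fun {X Y} hX hY h => ?_
  rcases Prod.Lex.toLex_lt_toLex.1 h with h | ⟨h, h'⟩
  · exact h
  · rw [P.column_unique X (mem_twoLine.1 hX) Y (mem_twoLine.1 hY) h] at h'
    exact absurd h' (lt_irrefl _)

theorem nodup_map_snd_twoLine {F : Finset (ℕ × ℕ)} (P : Placement F) :
    ((twoLine P).map Prod.snd).Nodup := by
  refine List.Nodup.map_on
    (fun X hX Y hY => P.row_unique X (mem_twoLine.1 hX) Y (mem_twoLine.1 hY)) ?_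
  exact ((twoLine_pairwise P).imp fun h => h.ne).of_map _ fun X Y h e => h (congrArg _ e)

theorem twoLine_eq {F : Finset (ℕ × ℕ)} {P : Placement F} {L : List (ℕ × ℕ)}
    (hL : (L.map Prod.fst).Pairwise (· < ·)) (h : ∀ X, X ∈ L ↔ X ∈ P.squares) :
    twoLine P = L := by
  have hP := twoLine_pairwise P
  rw [List.pairwise_map] at hP hL
  refine List.Perm.eq_of_pairwise (le := fun X Y => X.1 < Y.1) ?_ hP hL ?_
  · intro X Y _ _ h1 h2
    exact absurd h1 h2.not_gt
  · refine (List.perm_ext_iff_of_nodup ?_ ?_).2 fun X => mem_twoLine.trans (h X).symm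
    · exact hP.imp fun h e => h.ne (congrArg _ e)
    · exact hL.imp fun h e => h.ne (congrArg _ e)

theorem twoLine_leftPivots {m n : ℕ} (P : Placement (rectBoard m n)) :
    twoLine (leftPivots P) = pivotList (twoLine P) := by
  refine twoLine_eq ((twoLine_pairwise P).sublist (map_fst_pivotList_sublist _)) fun X => ?_
  have hP : P.squares = (twoLine P).toFinset := by
    ext Y
    rw [List.mem_toFinset, mem_twoLine]
  rw [show (leftPivots P).squares = leftPivotsUpTo P.squares n from rfl, hP,
    leftPivotsUpTo_toFinset (twoLine_pairwise P) (nodup_map_snd_twoLine P),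
    Finset.mem_filter, List.mem_toFinset]
  -- The cut-off at row `n` loses nothing: a bumped letter is a row of `P`.
  refine ⟨fun h => ⟨h, ?_⟩, And.left⟩
  have hX : X.2 ∈ (pivotList (twoLine P)).map Prod.snd := List.mem_map_of_mem h
  rw [map_snd_pivotList, List.mem_reverse] at hX
  have hX := (firstRow_append_bumpedWord_perm _).mem_iff.1 (List.mem_append_right _ hX)
  obtain ⟨Y, hY, e⟩ := List.mem_map.1 (List.mem_reverse.1 hX)
  have := P.subset_board (mem_twoLine.1 hY)
  simp only [rectBoard, Finset.mem_product, Finset.mem_Icc] at this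
  omega

end Rook

theorem mainTheorem5 (m n : ℕ) (P : Rook.Placement (Rook.rectBoard m n)) :
    Rook.ins (Rook.leftPivots P) = Rook.removeLeftColumn (Rook.ins P) := by
  have h := Rook.removeLeftColumn_insWord (Rook.nodup_map_snd_twoLine P)
  rw [← Rook.map_snd_pivotList, ← Rook.twoLine_leftPivots] at h
  exact h.symm
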